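/- **Improved residual barrier for $L_\infty(\Omega)$.** Let $\Omega\subset\mathbb R^d$ be a bounded open set (in particular, any bounded Lipschitz domain), $T>0$, $\alpha\in(0,1)$, and let $$L v=L(t)v:=-\sum_{i,j=1}^d\partial_{x_i}\bigl(a_{ij}(x,t)\,\partial_{x_j}v\bigr)+\sum_{i=1}^d b_i(x,t)\,\partial_{x_i}v+c(x,t)\,v,$$ where the matrix $\{a_{ij}(x,t)\}$ is symmetric positive definite for all $(x,t)\in\Omega\times(0,T]$, and $a_{ij}(\cdot,t)\in C^1(\Omega)$ for each $t\in(0,T]$ (no sign or boundedness condition is imposed on $c$). Let $D_t^\alpha$ be the Caputo derivative in time, $$D_t^\alpha w(t)=\frac1{\Gamma(1-\alpha)}\Bigl(\lim_{\varepsilon\to0^+}\int_\varepsilon^t(t-s)^{-\alpha}\,\partial_s w(s)\,ds+t^{-\alpha}\bigl(w(0^+)-w(0)\bigr)\Bigr),\qquad t>0,$$ which is $J_t^{1-\alpha}(\partial_t w)$, where a possible jump of $w$ at $t=0$ contributes a point mass to $\partial_t w$. Let $u$ be a solution of $$D_t^\alpha u+Lu=f\ \text{ in }\Omega\times(0,T],\qquad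 u(\cdot,0)=u_0\ \text{ in }\Omega,\qquad u=0\ \text{ on }\partial\Omega\ \text{ for } t\in(0,T],$$ and let $u_h$ be an approximation of $u$ with $u_h(\cdot,0)=u_0$ in $\Omega$, $u_h=0$ on $\partial\Omega$ for $t\in(0,T]$, and residual $R_h:=(D_t^\alpha+L)u_h-f$. Suppose that each $w\in\{u,u_h\}$ is continuous on $\bar\Omega\times(0,T]$, that $w(\cdot,t)\in C^2(\Omega)$ for each $t\in(0,T]$, and that, for each $x\in\Omega$, $w(x,\cdot)$ is continuous at $t=0$ and belongs to $W^1_\infty(\varepsilon,t)$ for all $0<\varepsilon<t\le T$. Suppose also that $\|(u_h-u)(\cdot,t)\|_{L_\infty(\Omega)}\to0$ as $t\to0^+$, and that $R_h(\cdot,t)$ is continuous in $\Omega$ for each $t\in(0,T]$. Suppose that, for some $\lambda,\omega\in\mathbb R$ with $\omega\ge0$, there is a function $g\in C^2(\Omega)$ such that $L(t)g\ge\lambda$ in $\Omega$ for all $t\in(0,T]$, and $1\le g\le1+\omega$ in $\Omega$. Let $\mathcal E:[0,T]\to[0,\infty)$ belong to $W^1_\infty(\varepsilon,t)$ (being its continuous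 representative on $(0,T]$) for all $0<\varepsilon<t\le T$, be such that $\lim_{t\to0^+}\mathcal E(t)$ exists (it may differ from $\mathcal E(0)$), and satisfy $\omega D_t^\alpha\mathcal E(t)\ge0$ and $$\|R_h(\cdot,t)\|_{L_\infty(\Omega)}\le\frac{(D_t^\alpha+\lambda)\mathcal E(t)}{1+\omega}\qquad\text{for all } t\in(0,T].$$ Then $$\|(u_h-u)(\cdot,t)\|_{L_\infty(\Omega)}\le\mathcal E(t)\qquad\text{for all } t\in[0,T].$$ -/

import Mathlib

open MeasureTheory Set Filter Topology
open scoped ENNReal NNReal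

noncomputable section

/-- The Riemann-Liouville fractional integral of order `β > 0`,
`J^β v (t) = Γ(β)⁻¹ ∫₀ᵗ (t - s)^(β - 1) v(s) ds`, the integral being improper at `s = 0`. -/
def fracIntegral (β : ℝ) (v : ℝ → ℝ) (t : ℝ) : ℝ :=
  (Real.Gamma β)⁻¹ *
    limUnder (𝓝[>] (0 : ℝ)) (fun ε : ℝ => ∫ s in ε..t, (t - s) ^ (β - 1) * v s)

/-- The Caputo derivative `D_t^α w = J^(1-α) (∂_t w)` of order `α ∈ (0,1)`. A jump of `w` at
`t = 0` contributes the point mass `(w(0+) - w(0)) δ₀` to `∂_t w`, hence the term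
`(w(0+) - w(0)) t^(-α) / Γ(1-α)`; it vanishes if `w` is continuous at `0`. -/
def caputo (α : ℝ) (w : ℝ → ℝ) (t : ℝ) : ℝ :=
  fracIntegral (1 - α) (deriv w) t
    + (Real.Gamma (1 - α))⁻¹ * t ^ (-α) * (Function.rightLim w 0 - w 0)

/-- Where the integral converges absolutely, `fracIntegral` is the ordinary integral over
`(0,t)`. -/
theorem fracIntegral_eq_integral {β t : ℝ} {v : ℝ → ℝ} (ht : 0 < t)
    (hv : IntervalIntegrable (fun s => (t - s) ^ (β - 1) * v s) volume 0 t) :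
    fracIntegral β v t =
      (Real.Gamma β)⁻¹ * ∫ s in (0 : ℝ)..t, (t - s) ^ (β - 1) * v s := by
  unfold fracIntegral
  congr 1
  apply Tendsto.limUnder_eq
  have h1 : ContinuousOn (fun ε : ℝ => ∫ s in ε..t, (t - s) ^ (β - 1) * v s) (uIcc 0 t) := by
    have h2 := intervalIntegral.continuousOn_primitive_interval'
      hv (right_mem_uIcc)
    have h3 := h2.neg
    refine h3.congr ?_
    intro ε _
    simp only [Pi.neg_apply]
    rw [intervalIntegral.integral_symm]
  have h4 : Tendsto (fun ε : ℝ => ∫ s in ε..t, (t - s) ^ (β - 1) * v s) (𝓝[uIcc 0 t] 0)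
      (𝓝 (∫ s in (0 : ℝ)..t, (t - s) ^ (β - 1) * v s)) := h1 0 left_mem_uIcc
  refine h4.mono_left ?_
  rw [uIcc_of_le ht.le, ← nhdsWithin_Ioc_eq_nhdsGT ht]
  exact nhdsWithin_mono _ Ioc_subset_Icc_self

/-- `w ∈ W^1_∞(ε,t)` for all `0 < ε < t ≤ T`, for the continuous representative: on a bounded
interval `W^1_∞` is the space of Lipschitz functions. -/
def LocW1Infty (T : ℝ) (w : ℝ → ℝ) : Prop :=
  ∀ ε t : ℝ, 0 < ε → ε < t → t ≤ T → ∃ K : ℝ≥0, LipschitzOnWith K w (Icc ε t)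

/-- The partial derivative `∂v/∂x_i`. -/
def pderiv {d : ℕ} (i : Fin d) (v : EuclideanSpace ℝ (Fin d) → ℝ)
    (x : EuclideanSpace ℝ (Fin d)) : ℝ :=
  fderiv ℝ v x (EuclideanSpace.single i 1)

/-- The operator
`L(t) v = - ∑_{i,j} ∂_i (a_{ij}(·,t) ∂_j v) + ∑_i b_i(·,t) ∂_i v + c(·,t) v` at the point `x`. -/
def ellipticOp {d : ℕ} (a : EuclideanSpace ℝ (Fin d) → ℝ → Matrix (Fin d) (Fin d) ℝ)
    (b : EuclideanSpace ℝ (Fin d) → ℝ → Fin d → ℝ) (c : EuclideanSpace ℝ (Fin d) → ℝ → ℝ)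
    (t : ℝ) (v : EuclideanSpace ℝ (Fin d) → ℝ) (x : EuclideanSpace ℝ (Fin d)) : ℝ :=
  -(∑ i, ∑ j, pderiv i (fun y => a y t i j * pderiv j v y) x)
    + (∑ i, b x t i * pderiv i v x) + c x t * v x

/-- `(D_t^α + L) w` at the point `(x,t)`. -/
def parabolicOp {d : ℕ} (α : ℝ)
    (a : EuclideanSpace ℝ (Fin d) → ℝ → Matrix (Fin d) (Fin d) ℝ)
    (b : EuclideanSpace ℝ (Fin d) → ℝ → Fin d → ℝ) (c : EuclideanSpace ℝ (Fin d) → ℝ → ℝ)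
    (w : EuclideanSpace ℝ (Fin d) → ℝ → ℝ) (x : EuclideanSpace ℝ (Fin d)) (t : ℝ) : ℝ :=
  caputo α (w x) t + ellipticOp a b c t (fun y => w y t) x

/-- The regularity asked of the solution and of its approximation, with the boundary
condition. -/
structure ClassicalRegularity {d : ℕ} (Ω : Set (EuclideanSpace ℝ (Fin d))) (T : ℝ)
    (w : EuclideanSpace ℝ (Fin d) → ℝ → ℝ) : Prop where
  contDiffOn_space : ∀ t ∈ Ioc 0 T, ContDiffOn ℝ 2 (fun x => w x t) Ω
  locW1Infty_time : ∀ x ∈ Ω, LocW1Infty T (w x)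
  continuous_at_zero : ∀ x ∈ Ω, Tendsto (w x) (𝓝[>] 0) (𝓝 (w x 0))
  continuousOn_closure :
    ContinuousOn (fun p : EuclideanSpace ℝ (Fin d) × ℝ => w p.1 p.2) (closure Ω ×ˢ Ioc 0 T)
  boundary : ∀ x ∈ frontier Ω, ∀ t ∈ Ioc 0 T, w x t = 0

/-- `u` solves `D_t^α u + L u = f` in `Ω × (0,T]`, `u(·,0) = u₀` in `Ω`, `u = 0` on `∂Ω` for
`t > 0`. -/
structure IsClassicalSolution {d : ℕ} (Ω : Set (EuclideanSpace ℝ (Fin d))) (T α : ℝ)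
    (a : EuclideanSpace ℝ (Fin d) → ℝ → Matrix (Fin d) (Fin d) ℝ)
    (b : EuclideanSpace ℝ (Fin d) → ℝ → Fin d → ℝ) (c : EuclideanSpace ℝ (Fin d) → ℝ → ℝ)
    (f : EuclideanSpace ℝ (Fin d) → ℝ → ℝ) (u₀ : EuclideanSpace ℝ (Fin d) → ℝ)
    (u : EuclideanSpace ℝ (Fin d) → ℝ → ℝ) : Prop where
  regular : ClassicalRegularity Ω T u
  equation : ∀ x ∈ Ω, ∀ t ∈ Ioc 0 T, parabolicOp α a b c u x t = f x t
  initial : ∀ x ∈ Ω, u x 0 = u₀ x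

/-- The residual `R_h = (D_t^α + L) u_h - f`. -/
def problemResidual {d : ℕ} (α : ℝ)
    (a : EuclideanSpace ℝ (Fin d) → ℝ → Matrix (Fin d) (Fin d) ℝ)
    (b : EuclideanSpace ℝ (Fin d) → ℝ → Fin d → ℝ) (c : EuclideanSpace ℝ (Fin d) → ℝ → ℝ)
    (f uh : EuclideanSpace ℝ (Fin d) → ℝ → ℝ) (x : EuclideanSpace ℝ (Fin d)) (t : ℝ) : ℝ :=
  parabolicOp α a b c uh x t - f x t

/-- The norm of `L_∞(Ω)` (essential supremum), with value `∞` on unbounded functions. -/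
def linftyNorm {d : ℕ} (Ω : Set (EuclideanSpace ℝ (Fin d)))
    (v : EuclideanSpace ℝ (Fin d) → ℝ) : ℝ≥0∞ :=
  eLpNorm v ⊤ (volume.restrict Ω)

end

/-!
# The residual barrier for the time-fractional parabolic problem

For either sign, the error `e = ±(u_h - u)` satisfies `(D_t^α + L) e = ±R_h`. Since `L g ≥ lam`,
`g ≥ 1` and `ω D_t^α E ≥ 0`, the function `g(x) E(t) / (1 + ω)`, which is at most `E(t)`, satisfies
`(D_t^α + L)(g E) / (1 + ω) ≥ (D_t^α + lam) E / (1 + ω) ≥ ‖R_h‖`. It is a barrier for the error, and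
the estimate is a comparison principle (`le_of_parabolicOp_le`).

No sign of `c` or `lam` is available, so the comparison is made with a strict barrier `g P`
(`lt_of_parabolicOp_lt`), at the first time `t₀` when the error touches it (`exists_first_contact`).
At a contact point `x₀`, the function `e(·,t₀) - P(t₀) g` has a maximum with value zero, so that the
zeroth-order term of `L` drops out and `L e ≥ P(t₀) L g` (`ellipticOp_nonneg_of_isLocalMax`).
Likewise `e(x₀,·) - g(x₀) P` has its maximum over the past at `t₀`, so that
`D_t^α e ≥ g(x₀) D_t^α P` (`CaputoRegular.caputo_nonneg_of_forall_le`, by an integration by parts).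
Together these contradict the strict differential inequality.

Strictness comes from `P = E / (1 + ω) + δ Ψ`, where `Ψ` vanishes at `t = 0` and equals `e^{μ t}` for
`t > 0`. The jump at `t = 0` and a large rate `μ` give `D_t^α Ψ ≥ (|lam| + 1) Ψ` at all positive times
(`exists_mul_jumpExp_le_caputo`); then `δ → 0`.
-/

/-! ### The Caputo derivative -/

/-- The functions of time on which the Caputo derivative is meaningful: locally Lipschitz on
`(0,T]`, with a limit at `0+` that need not be the value at `0`. -/
def CaputoRegular (T : ℝ) (w : ℝ → ℝ) : Prop :=
  LocW1Infty T w ∧ ∃ l : ℝ, Tendsto w (𝓝[>] 0) (𝓝 l)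

theorem LocW1Infty.absolutelyContinuousOnInterval {T : ℝ} {w : ℝ → ℝ} (hw : LocW1Infty T w)
    {ε t : ℝ} (hε : 0 < ε) (hεt : ε < t) (ht : t ≤ T) :
    AbsolutelyContinuousOnInterval w ε t := by
  obtain ⟨K, hK⟩ := hw ε t hε hεt ht
  rw [← uIcc_of_le hεt.le] at hK
  exact hK.absolutelyContinuousOnInterval

theorem LocW1Infty.continuousOn {T : ℝ} {w : ℝ → ℝ} (hw : LocW1Infty T w) :
    ContinuousOn w (Ioc 0 T) := by
  intro t ht
  obtain ⟨K, hK⟩ := hw (t / 2) t (by linarith [ht.1]) (by linarith [ht.1]) ht.2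
  rcases ht.2.eq_or_lt with h | h
  · refine (hK.continuousOn t ⟨by linarith [ht.1], le_rfl⟩).mono_of_mem_nhdsWithin ?_
    subst h
    filter_upwards [self_mem_nhdsWithin,
      mem_nhdsWithin_of_mem_nhds (Ioi_mem_nhds (show t / 2 < t by linarith [ht.1]))] with s h1 h2
    exact ⟨le_of_lt h2, h1.2⟩
  · obtain ⟨K, hK⟩ := hw (t / 2) T (by linarith [ht.1]) (by linarith [ht.1]) le_rfl
    refine (hK.continuousOn t ⟨by linarith [ht.1], h.le⟩).mono_of_mem_nhdsWithin ?_
    exact mem_nhdsWithin_of_mem_nhds (Icc_mem_nhds (by linarith [ht.1]) h)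

theorem LocW1Infty.linearCombination {T : ℝ} {v w : ℝ → ℝ} (hv : LocW1Infty T v)
    (hw : LocW1Infty T w) (A B : ℝ) : LocW1Infty T (fun s => A * v s + B * w s) := by
  intro ε t hε hεt ht
  obtain ⟨K, hK⟩ := hv ε t hε hεt ht
  obtain ⟨M, hM⟩ := hw ε t hε hεt ht
  have h1 : LipschitzOnWith (‖A‖₊ * K) (fun s => A * v s) (Icc ε t) :=
    (lipschitzWith_smul A).comp_lipschitzOnWith hK
  have h2 : LipschitzOnWith (‖B‖₊ * M) (fun s => B * w s) (Icc ε t) :=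
    (lipschitzWith_smul B).comp_lipschitzOnWith hM
  exact ⟨_, h1.add h2⟩

theorem CaputoRegular.linearCombination {T : ℝ} {v w : ℝ → ℝ} (hv : CaputoRegular T v)
    (hw : CaputoRegular T w) (A B : ℝ) : CaputoRegular T (fun s => A * v s + B * w s) := by
  obtain ⟨l, hl⟩ := hv.2
  obtain ⟨m, hm⟩ := hw.2
  exact ⟨hv.1.linearCombination hw.1 A B, _, (hl.const_mul A).add (hm.const_mul B)⟩

theorem intervalIntegrable_caputo_kernel {α : ℝ} (hα : α < 1) (t a b : ℝ) :
    IntervalIntegrable (fun s => (t - s) ^ (-α)) volume a b := by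
  have := (intervalIntegral.intervalIntegrable_rpow' (a := t - a) (b := t - b)
    (r := -α) (by linarith)).comp_sub_left t
  simpa using this

theorem LocW1Infty.intervalIntegrable_kernel_mul_deriv {T α : ℝ} {w : ℝ → ℝ}
    (hw : LocW1Infty T w) (hα : α < 1) {ε t : ℝ} (hε : 0 < ε) (hεt : ε < t) (ht : t ≤ T) :
    IntervalIntegrable (fun s => (t - s) ^ (-α) * deriv w s) volume ε t := by
  obtain ⟨K, hK⟩ := hw ε t hε hεt ht
  have h1 := intervalIntegrable_caputo_kernel hα t ε t
  rw [intervalIntegrable_iff_integrableOn_Ioo_of_le hεt.le] at h1 ⊢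
  refine h1.mul_bdd (c := K) (aestronglyMeasurable_deriv w _) ?_
  filter_upwards [self_mem_ae_restrict measurableSet_Ioo] with s hs
  exact norm_deriv_le_of_lipschitzOn (Icc_mem_nhds hs.1 hs.2) hK

theorem hasDerivAt_caputo_kernel (α : ℝ) {t s : ℝ} (hs : s < t) :
    HasDerivAt (fun s => (t - s) ^ (-α)) (α * (t - s) ^ (-α - 1)) s := by
  have h1 : HasDerivAt (fun s => t - s) (-1) s := by
    simpa using (hasDerivAt_id s).const_sub t
  have := h1.rpow_const (p := -α) (Or.inl (by linarith))
  convert this using 1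
  ring

theorem continuousOn_deriv_caputo_kernel (α : ℝ) {t a b : ℝ} (hb : b < t) :
    ContinuousOn (fun s => α * (t - s) ^ (-α - 1)) (Icc a b) := by
  refine ContinuousOn.mul continuousOn_const (ContinuousOn.rpow_const (by fun_prop) ?_)
  intro s hs
  left
  linarith [hs.2]

/-- Integration by parts away from the singularity of the kernel, with an arbitrary constant of
integration `m`. -/
theorem LocW1Infty.integral_kernel_mul_deriv {T : ℝ} (α : ℝ) {w : ℝ → ℝ} (hw : LocW1Infty T w)
    (m : ℝ) {ε r t : ℝ} (hε : 0 < ε) (hεr : ε < r) (hrt : r < t) (ht : t ≤ T) :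
    ∫ s in ε..r, (t - s) ^ (-α) * deriv w s =
      (t - r) ^ (-α) * (w r - m) - (t - ε) ^ (-α) * (w ε - m)
        - ∫ s in ε..r, α * (t - s) ^ (-α - 1) * (w s - m) := by
  have hk : AbsolutelyContinuousOnInterval (fun s => (t - s) ^ (-α)) ε r := by
    obtain ⟨C, hC⟩ := isCompact_Icc.exists_bound_of_continuousOn
      (continuousOn_deriv_caputo_kernel α (a := ε) hrt)
    have : LipschitzOnWith C.toNNReal (fun s => (t - s) ^ (-α)) (Icc ε r) := by
      refine (convex_Icc ε r).lipschitzOnWith_of_nnnorm_hasDerivWithin_le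
        (fun s hs => (hasDerivAt_caputo_kernel α (hs.2.trans_lt hrt)).hasDerivWithinAt) ?_
      intro s hs
      exact NNReal.le_toNNReal_of_coe_le (hC s hs)
    rw [← uIcc_of_le hεr.le] at this
    exact this.absolutelyContinuousOnInterval
  obtain ⟨K, hK⟩ := hw ε r hε hεr (hrt.le.trans ht)
  have hwm : AbsolutelyContinuousOnInterval (fun s => w s - m) ε r := by
    have : LipschitzOnWith K (fun s => w s - m) (uIcc ε r) := by
      rw [uIcc_of_le hεr.le]
      intro x hx y hy
      simpa [edist_dist, Real.dist_eq] using hK hx hy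
    exact this.absolutelyContinuousOnInterval
  have := hk.integral_mul_deriv_eq_deriv_mul hwm
  simp only [deriv_sub_const_fun] at this
  rw [this]
  congr 1
  refine intervalIntegral.integral_congr fun s hs => ?_
  rw [uIcc_of_le hεr.le] at hs
  simp only [(hasDerivAt_caputo_kernel α (hs.2.trans_lt hrt)).deriv]

theorem tendsto_intervalIntegral_nhdsGT_zero {f : ℝ → ℝ} {r : ℝ} (hr : 0 < r)
    (hf : IntervalIntegrable f volume 0 r) :
    Tendsto (fun ε : ℝ => ∫ s in ε..r, f s) (𝓝[>] 0) (𝓝 (∫ s in (0 : ℝ)..r, f s)) := by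
  have h1 := intervalIntegral.continuousOn_primitive_interval' hf right_mem_uIcc 0 left_mem_uIcc
  rw [uIcc_of_le hr.le] at h1
  have h2 := (h1.tendsto.mono_left (nhdsWithin_mono _ Ioc_subset_Icc_self)).neg
  rw [nhdsWithin_Ioc_eq_nhdsGT hr] at h2
  simpa only [← intervalIntegral.integral_symm] using h2

/-- The improper integral in the Caputo derivative converges. -/
theorem CaputoRegular.exists_tendsto {T α : ℝ} {w : ℝ → ℝ} (hw : CaputoRegular T w)
    (hα : α < 1) {t : ℝ} (ht : t ∈ Ioc 0 T) :
    ∃ I : ℝ, Tendsto (fun ε : ℝ => ∫ s in ε..t, (t - s) ^ (-α) * deriv w s) (𝓝[>] 0) (𝓝 I) := by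
  obtain ⟨ht0, htT⟩ := ht
  obtain ⟨l, hl⟩ := hw.2
  set r := t / 2 with hr
  have hr0 : 0 < r := by positivity
  have hrt : r < t := by linarith
  have hint : IntervalIntegrable (fun s => α * (t - s) ^ (-α - 1) * (w s - 0)) volume 0 r := by
    have hcont : ContinuousOn (Function.update w 0 l) (Icc 0 r) := by
      intro s hs
      rcases hs.1.eq_or_lt with h | h
      · subst h
        rw [continuousWithinAt_update_same]
        exact hl.mono_left (nhdsWithin_mono _ fun x hx => lt_of_le_of_ne hx.1.1 (Ne.symm hx.2))
      · have h1 : ContinuousWithinAt w (Ioc 0 T) s :=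
          hw.1.continuousOn s ⟨h, by linarith [hs.2]⟩
        have h2 : ContinuousWithinAt w (Icc 0 r) s := by
          refine h1.mono_of_mem_nhdsWithin ?_
          filter_upwards [self_mem_nhdsWithin, mem_nhdsWithin_of_mem_nhds (Ioi_mem_nhds h)]
            with x hx hx0
          exact ⟨hx0, by linarith [hx.2]⟩
        exact (continuousWithinAt_update_of_ne h.ne').2 h2
    have h1 : IntervalIntegrable
        (fun s => α * (t - s) ^ (-α - 1) * Function.update w 0 l s) volume 0 r :=
      ContinuousOn.intervalIntegrable_of_Icc hr0.le
        ((continuousOn_deriv_caputo_kernel α hrt).mul hcont)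
    refine h1.congr fun s hs => ?_
    rw [uIoc_of_le hr0.le] at hs
    simp [Function.update_of_ne hs.1.ne']
  have hlim : Tendsto (fun ε : ℝ => ∫ s in ε..r, α * (t - s) ^ (-α - 1) * (w s - 0)) (𝓝[>] 0)
      (𝓝 (∫ s in (0 : ℝ)..r, α * (t - s) ^ (-α - 1) * (w s - 0))) :=
    tendsto_intervalIntegral_nhdsGT_zero hr0 hint
  have hker : Tendsto (fun ε : ℝ => (t - ε) ^ (-α)) (𝓝[>] 0) (𝓝 ((t - 0) ^ (-α))) :=
    (hasDerivAt_caputo_kernel α ht0).continuousAt.tendsto.mono_left nhdsWithin_le_nhds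
  refine ⟨_, (((tendsto_const_nhds (x := (t - r) ^ (-α) * (w r - 0))).sub
    (hker.mul (hl.sub_const 0))).sub hlim |>.add_const
      (∫ s in r..t, (t - s) ^ (-α) * deriv w s)).congr' ?_⟩
  filter_upwards [Ioo_mem_nhdsGT hr0] with ε hε
  rw [← hw.1.integral_kernel_mul_deriv α 0 hε.1 hε.2 hrt htT]
  have h5 := hw.1.intervalIntegrable_kernel_mul_deriv hα hε.1 (hε.2.trans hrt) htT
  refine intervalIntegral.integral_add_adjacent_intervals (h5.mono_set ?_)
    (h5.mono_set ?_)
  · rw [uIcc_of_le hε.2.le, uIcc_of_le (hε.2.trans hrt).le]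
    exact Icc_subset_Icc_right hrt.le
  · rw [uIcc_of_le hrt.le, uIcc_of_le (hε.2.trans hrt).le]
    exact Icc_subset_Icc_left hε.2.le

theorem caputo_eq_of_tendsto {α t l I : ℝ} {w : ℝ → ℝ} (hl : Tendsto w (𝓝[>] 0) (𝓝 l))
    (hI : Tendsto (fun ε : ℝ => ∫ s in ε..t, (t - s) ^ (-α) * deriv w s) (𝓝[>] 0) (𝓝 I)) :
    caputo α w t = (Real.Gamma (1 - α))⁻¹ * (I + t ^ (-α) * (l - w 0)) := by
  have h1 : (1 - α - 1 : ℝ) = -α := by ring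
  rw [caputo, fracIntegral, h1, hI.limUnder_eq, rightLim_eq_of_tendsto hl]
  ring

theorem CaputoRegular.caputo_linearCombination {T α : ℝ} {v w : ℝ → ℝ} (hv : CaputoRegular T v)
    (hw : CaputoRegular T w) (hα : α < 1) (A B : ℝ) {t : ℝ} (ht : t ∈ Ioc 0 T) :
    caputo α (fun s => A * v s + B * w s) t = A * caputo α v t + B * caputo α w t := by
  obtain ⟨l, hl⟩ := hv.2
  obtain ⟨m, hm⟩ := hw.2
  obtain ⟨I, hI⟩ := hv.exists_tendsto hα ht
  obtain ⟨J, hJ⟩ := hw.exists_tendsto hα ht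
  rw [caputo_eq_of_tendsto hl hI, caputo_eq_of_tendsto hm hJ,
    caputo_eq_of_tendsto ((hl.const_mul A).add (hm.const_mul B)) (I := A * I + B * J)]
  · ring
  refine ((hI.const_mul A).add (hJ.const_mul B)).congr' ?_
  filter_upwards [Ioo_mem_nhdsGT ht.1] with ε hε
  have h1 := hv.1.intervalIntegrable_kernel_mul_deriv hα hε.1 hε.2 ht.2
  have h2 := hw.1.intervalIntegrable_kernel_mul_deriv hα hε.1 hε.2 ht.2
  rw [← intervalIntegral.integral_const_mul, ← intervalIntegral.integral_const_mul,
    ← intervalIntegral.integral_add (h1.const_mul A) (h2.const_mul B)]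
  refine intervalIntegral.integral_congr_ae ?_
  filter_upwards [(hv.1.absolutelyContinuousOnInterval hε.1 hε.2 ht.2).ae_differentiableAt,
    (hw.1.absolutelyContinuousOnInterval hε.1 hε.2 ht.2).ae_differentiableAt] with s hs1 hs2 hs
  have hs' := uIoc_subset_uIcc hs
  have h3 : deriv (fun s => A * v s + B * w s) s = A * deriv v s + B * deriv w s :=
    (((hs1 hs').hasDerivAt.const_mul A).add ((hs2 hs').hasDerivAt.const_mul B)).deriv
  rw [h3]
  ring

/-- The Caputo derivative is nonnegative at a time where the function attains its maximum over
the past, the initial value included. -/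
theorem CaputoRegular.caputo_nonneg_of_forall_le {T α : ℝ} {w : ℝ → ℝ} (hw : CaputoRegular T w)
    (hα : α ∈ Ioo (0 : ℝ) 1) {t : ℝ} (ht : t ∈ Ioc 0 T) (hmax : ∀ s ∈ Icc 0 t, w s ≤ w t) :
    0 ≤ caputo α w t := by
  obtain ⟨l, hl⟩ := hw.2
  obtain ⟨I, hI⟩ := hw.exists_tendsto hα.2 ht
  rw [caputo_eq_of_tendsto hl hI]
  have hΓ : 0 < Real.Gamma (1 - α) := Real.Gamma_pos_of_pos (by linarith [hα.2])
  have ht' : 0 < t ^ (-α) := Real.rpow_pos_of_pos ht.1 _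
  -- The integral over `(ε, t)` is bounded below by the boundary term at `ε`.
  have hbound : ∀ ε ∈ Ioo 0 t, -((t - ε) ^ (-α) * (w ε - w t)) ≤
      ∫ s in ε..t, (t - s) ^ (-α) * deriv w s := by
    intro ε hε
    obtain ⟨K, hK⟩ := hw.1 ε t hε.1 hε.2 ht.2
    have hint := hw.1.intervalIntegrable_kernel_mul_deriv hα.2 hε.1 hε.2 ht.2
    have hlim : Tendsto (fun r : ℝ => ∫ s in ε..r, (t - s) ^ (-α) * deriv w s) (𝓝[<] t)
        (𝓝 (∫ s in ε..t, (t - s) ^ (-α) * deriv w s)) := by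
      have h3 := intervalIntegral.continuousOn_primitive_interval' hint left_mem_uIcc
        t right_mem_uIcc
      rw [uIcc_of_le hε.2.le] at h3
      have h4 := h3.tendsto.mono_left (nhdsWithin_mono _ Ico_subset_Icc_self)
      rwa [nhdsWithin_Ico_eq_nhdsLT hε.2] at h4
    -- The boundary term at `t` vanishes in the limit: `w` is Lipschitz and `α < 1`.
    have hlow : Tendsto (fun r : ℝ => -(K * (t - r) ^ (1 - α)) - (t - ε) ^ (-α) * (w ε - w t))
        (𝓝[<] t) (𝓝 (-((t - ε) ^ (-α) * (w ε - w t)))) := by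
      have h1 : ContinuousAt
          (fun r : ℝ => -(K * (t - r) ^ (1 - α)) - (t - ε) ^ (-α) * (w ε - w t)) t := by
        refine ContinuousAt.sub (ContinuousAt.neg (continuousAt_const.mul ?_)) continuousAt_const
        exact ContinuousAt.rpow_const (by fun_prop) (Or.inr (by linarith [hα.2]))
      have h2 := h1.tendsto.mono_left (nhdsWithin_le_nhds (s := Iio t))
      have h3 : (0 : ℝ) ^ (1 - α) = 0 := Real.zero_rpow (by linarith [hα.2])
      simpa [h3] using h2
    refine le_of_tendsto_of_tendsto hlow hlim ?_
    filter_upwards [Ioo_mem_nhdsLT hε.2] with r hr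
    rw [hw.1.integral_kernel_mul_deriv α (w t) hε.1 hr.1 hr.2 ht.2]
    have htr : 0 < t - r := by linarith [hr.2]
    have h1 : ∫ s in ε..r, α * (t - s) ^ (-α - 1) * (w s - w t) ≤ 0 := by
      have : 0 ≤ ∫ s in ε..r, -(α * (t - s) ^ (-α - 1) * (w s - w t)) := by
        refine intervalIntegral.integral_nonneg hr.1.le fun s hs => ?_
        have h2 : 0 ≤ α * (t - s) ^ (-α - 1) :=
          mul_nonneg hα.1.le (Real.rpow_nonneg (by linarith [hs.2]) _)
        have h3 := hmax s ⟨by linarith [hs.1, hε.1], by linarith [hs.2]⟩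
        nlinarith
      rw [intervalIntegral.integral_neg] at this
      linarith
    have h2 : -(K * (t - r) ^ (1 - α)) ≤ (t - r) ^ (-α) * (w r - w t) := by
      have h3 := hK.dist_le_mul t ⟨hε.2.le, le_rfl⟩ r ⟨hr.1.le, hr.2.le⟩
      rw [Real.dist_eq, Real.dist_eq, abs_of_pos htr] at h3
      have h4 := (le_abs_self _).trans h3
      have h5 : (t - r) ^ (1 - α) = (t - r) ^ (-α) * (t - r) := by
        rw [← Real.rpow_add_one htr.ne']
        ring_nf
      rw [h5]
      have h6 := mul_le_mul_of_nonneg_left h4 (Real.rpow_nonneg htr.le (-α))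
      nlinarith
    linarith
  have hker : Tendsto (fun ε : ℝ => (t - ε) ^ (-α)) (𝓝[>] 0) (𝓝 ((t - 0) ^ (-α))) :=
    (hasDerivAt_caputo_kernel α ht.1).continuousAt.tendsto.mono_left nhdsWithin_le_nhds
  have hI' : -((t - 0) ^ (-α) * (l - w t)) ≤ I := by
    refine le_of_tendsto_of_tendsto (hker.mul (hl.sub_const (w t))).neg hI ?_
    filter_upwards [Ioo_mem_nhdsGT ht.1] with ε hε using hbound ε hε
  rw [sub_zero] at hI'
  refine mul_nonneg (inv_nonneg.2 hΓ.le) ?_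
  have := hmax 0 ⟨le_rfl, ht.1.le⟩
  nlinarith

/-- The exponential `e^{μ t}` on `(0,∞)`, started from the value `0`. Its jump at `t = 0` gives the
Caputo derivative the positive term `t^{-α}/Γ(1-α)`, without which it would vanish as `t → 0+`. -/
noncomputable def jumpExp (μ t : ℝ) : ℝ := if 0 < t then Real.exp (μ * t) else 0

theorem jumpExp_of_pos (μ : ℝ) {t : ℝ} (ht : 0 < t) : jumpExp μ t = Real.exp (μ * t) := by
  simp [jumpExp, ht]

theorem jumpExp_zero (μ : ℝ) : jumpExp μ 0 = 0 := by simp [jumpExp]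

theorem tendsto_jumpExp (μ : ℝ) : Tendsto (jumpExp μ) (𝓝[>] 0) (𝓝 1) := by
  have h : Tendsto (fun t => Real.exp (μ * t)) (𝓝[>] 0) (𝓝 1) := by
    have : Continuous fun t => Real.exp (μ * t) := by fun_prop
    simpa using (this.tendsto 0).mono_left (nhdsWithin_le_nhds (s := Ioi 0))
  refine h.congr' ?_
  filter_upwards [self_mem_nhdsWithin] with t ht using (jumpExp_of_pos μ ht).symm

theorem hasDerivAt_exp_const_mul (μ t : ℝ) :
    HasDerivAt (fun s => Real.exp (μ * s)) (μ * Real.exp (μ * t)) t := by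
  have := ((hasDerivAt_id t).const_mul μ).exp
  simpa [mul_comm] using this

theorem deriv_jumpExp (μ : ℝ) {t : ℝ} (ht : 0 < t) :
    deriv (jumpExp μ) t = μ * Real.exp (μ * t) := by
  have h : jumpExp μ =ᶠ[𝓝 t] fun s => Real.exp (μ * s) := by
    filter_upwards [Ioi_mem_nhds ht] with s hs using jumpExp_of_pos μ hs
  rw [h.deriv_eq, (hasDerivAt_exp_const_mul μ t).deriv]

theorem caputoRegular_jumpExp (T μ : ℝ) : CaputoRegular T (jumpExp μ) := by
  refine ⟨fun ε t hε _ _ => ?_, 1, tendsto_jumpExp μ⟩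
  obtain ⟨C, hC⟩ := (isCompact_Icc (a := ε) (b := t)).exists_bound_of_continuousOn
    (f := fun s => μ * Real.exp (μ * s)) (by fun_prop)
  refine ⟨C.toNNReal, ?_⟩
  have : LipschitzOnWith C.toNNReal (fun s => Real.exp (μ * s)) (Icc ε t) :=
    (convex_Icc ε t).lipschitzOnWith_of_nnnorm_hasDerivWithin_le
      (fun s _ => (hasDerivAt_exp_const_mul μ s).hasDerivWithinAt)
      (fun s hs => NNReal.le_toNNReal_of_coe_le (hC s hs))
  intro x hx y hy
  rw [jumpExp_of_pos μ (hε.trans_le hx.1), jumpExp_of_pos μ (hε.trans_le hy.1)]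
  exact this hx hy

/-- For every `K`, a rate `μ` large enough makes the exponential with a jump at `0` a
supersolution of `D_t^α Ψ = K Ψ`, at all positive times. -/
theorem exists_mul_jumpExp_le_caputo {α : ℝ} (hα : α ∈ Ioo (0 : ℝ) 1) (K : ℝ) :
    ∃ μ : ℝ, 0 ≤ μ ∧ ∀ t : ℝ, 0 < t → K * jumpExp μ t ≤ caputo α (jumpExp μ) t := by
  have hΓ : 0 < Real.Gamma (1 - α) := Real.Gamma_pos_of_pos (by linarith [hα.2])
  -- A window `h` so short that the kernel on it is at least `2 K Γ(1 - α)`.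
  obtain ⟨h, hh, hK⟩ : ∃ h : ℝ, 0 < h ∧ 2 * K * Real.Gamma (1 - α) ≤ h ^ (-α) := by
    have h1 := tendsto_rpow_neg_nhdsGT_zero (y := -α) (by linarith [hα.1])
    obtain ⟨h, h2, h3⟩ := ((h1.eventually_ge_atTop (2 * K * Real.Gamma (1 - α))).and
      self_mem_nhdsWithin).exists
    exact ⟨h, h3, h2⟩
  refine ⟨1 / h, by positivity, fun t ht => ?_⟩
  set μ := 1 / h with hμ
  have hμ0 : 0 < μ := by positivity
  have hint : ∀ a b : ℝ, IntervalIntegrable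
      (fun s => (t - s) ^ (-α) * (μ * Real.exp (μ * s))) volume a b := fun a b =>
    (intervalIntegrable_caputo_kernel hα.2 t a b).mul_continuousOn (by fun_prop)
  have hI : Tendsto (fun ε : ℝ => ∫ s in ε..t, (t - s) ^ (-α) * deriv (jumpExp μ) s) (𝓝[>] 0)
      (𝓝 (∫ s in (0 : ℝ)..t, (t - s) ^ (-α) * (μ * Real.exp (μ * s)))) := by
    refine (tendsto_intervalIntegral_nhdsGT_zero ht (hint 0 t)).congr' ?_
    filter_upwards [Ioo_mem_nhdsGT ht] with ε hε
    refine intervalIntegral.integral_congr fun s hs => ?_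
    rw [uIcc_of_le hε.2.le] at hs
    simp only [deriv_jumpExp μ (hε.1.trans_le hs.1)]
  rw [caputo_eq_of_tendsto (tendsto_jumpExp μ) hI, jumpExp_zero, jumpExp_of_pos μ ht]
  -- Only the last stretch of length `k = min t h` of the past is needed.
  set k := min t h with hk
  have hk0 : 0 < k := lt_min ht hh
  have hkt : k ≤ t := min_le_left _ _
  have hker : h ^ (-α) ≤ k ^ (-α) :=
    Real.rpow_le_rpow_of_nonpos hk0 (min_le_right _ _) (by linarith [hα.1])
  have hpart : ∫ s in (t - k)..t, (t - s) ^ (-α) * (μ * Real.exp (μ * s)) ≤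
      ∫ s in (0 : ℝ)..t, (t - s) ^ (-α) * (μ * Real.exp (μ * s)) := by
    refine intervalIntegral.integral_mono_interval (by linarith) (by linarith) le_rfl ?_ (hint 0 t)
    filter_upwards [self_mem_ae_restrict measurableSet_Ioc] with s hs
    have : 0 ≤ (t - s) ^ (-α) := Real.rpow_nonneg (by linarith [hs.2]) _
    simp only [Pi.zero_apply]
    positivity
  have hlast : k ^ (-α) * (Real.exp (μ * t) - Real.exp (μ * (t - k))) ≤
      ∫ s in (t - k)..t, (t - s) ^ (-α) * (μ * Real.exp (μ * s)) := by
    have h1 : ∫ s in (t - k)..t, μ * Real.exp (μ * s) =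
        Real.exp (μ * t) - Real.exp (μ * (t - k)) :=
      intervalIntegral.integral_eq_sub_of_hasDerivAt
        (f := fun s => Real.exp (μ * s)) (fun s _ => hasDerivAt_exp_const_mul μ s)
        (Continuous.intervalIntegrable (by fun_prop) _ _)
    rw [← h1, ← intervalIntegral.integral_const_mul]
    refine intervalIntegral.integral_mono_on_of_le_Ioo (by linarith)
      (Continuous.intervalIntegrable (by fun_prop) _ _) (hint _ _) fun s hs => ?_
    refine mul_le_mul_of_nonneg_right ?_ (by positivity)
    exact Real.rpow_le_rpow_of_nonpos (by linarith [hs.2]) (by linarith [hs.1]) (by linarith [hα.1])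
  have hexp : 0 < Real.exp (μ * t) := Real.exp_pos _
  have hkα : 0 < h ^ (-α) := Real.rpow_pos_of_pos hh _
  have htα : 0 < t ^ (-α) := Real.rpow_pos_of_pos ht _
  have hmain : h ^ (-α) * Real.exp (μ * t) / 2 ≤
      k ^ (-α) * (Real.exp (μ * t) - Real.exp (μ * (t - k))) + t ^ (-α) * (1 - 0) := by
    rcases le_total t h with hth | hth
    · have hkeq : k = t := min_eq_left hth
      rw [hkeq] at hker ⊢
      simp only [sub_self, mul_zero, Real.exp_zero]
      nlinarith
    · have hkeq : k = h := min_eq_right hth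
      have h3 : Real.exp (μ * (t - h)) = Real.exp (μ * t) * Real.exp (-1) := by
        rw [← Real.exp_add]
        congr 1
        rw [hμ]
        field_simp
        ring
      have h4 : Real.exp (-1) ≤ 1 / 2 := by
        have := Real.add_one_le_exp 1
        rw [Real.exp_neg, inv_eq_one_div]
        exact one_div_le_one_div_of_le (by norm_num) (by linarith)
      rw [hkeq, h3]
      have h5 : Real.exp (μ * t) * Real.exp (-1) ≤ Real.exp (μ * t) * (1 / 2) :=
        mul_le_mul_of_nonneg_left h4 hexp.le
      nlinarith
  have hfin : Real.Gamma (1 - α) * (K * Real.exp (μ * t)) ≤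
      (∫ s in (0 : ℝ)..t, (t - s) ^ (-α) * (μ * Real.exp (μ * s))) + t ^ (-α) * (1 - 0) := by
    have := mul_le_mul_of_nonneg_right hK hexp.le
    linarith
  rw [inv_mul_eq_div, le_div_iff₀ hΓ]
  linarith

/-! ### The elliptic operator -/

theorem contDiffOn_pderiv {d : ℕ} {Ω : Set (EuclideanSpace ℝ (Fin d))} (hΩ : IsOpen Ω)
    {v : EuclideanSpace ℝ (Fin d) → ℝ} (hv : ContDiffOn ℝ 2 v Ω) (j : Fin d) :
    ContDiffOn ℝ 1 (pderiv j v) Ω :=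
  (hv.fderiv_of_isOpen hΩ (m := 1) (by norm_num)).clm_apply contDiffOn_const

theorem pderiv_linearCombination {d : ℕ} {v w : EuclideanSpace ℝ (Fin d) → ℝ}
    {x : EuclideanSpace ℝ (Fin d)} (hv : DifferentiableAt ℝ v x) (hw : DifferentiableAt ℝ w x)
    (i : Fin d) (A B : ℝ) :
    pderiv i (fun y => A * v y + B * w y) x = A * pderiv i v x + B * pderiv i w x := by
  have h := ((hv.hasFDerivAt.const_mul A).add (hw.hasFDerivAt.const_mul B)).fderiv
  have h' : fderiv ℝ (fun y => A * v y + B * w y) x = A • fderiv ℝ v x + B • fderiv ℝ w x := h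
  simp [pderiv, h']

theorem ellipticOp_linearCombination {d : ℕ} {Ω : Set (EuclideanSpace ℝ (Fin d))}
    (hΩ : IsOpen Ω) {a : EuclideanSpace ℝ (Fin d) → ℝ → Matrix (Fin d) (Fin d) ℝ}
    (b : EuclideanSpace ℝ (Fin d) → ℝ → Fin d → ℝ) (c : EuclideanSpace ℝ (Fin d) → ℝ → ℝ)
    {t : ℝ} (ha : ∀ i j, ContDiffOn ℝ 1 (fun x => a x t i j) Ω)
    {v w : EuclideanSpace ℝ (Fin d) → ℝ} (hv : ContDiffOn ℝ 2 v Ω) (hw : ContDiffOn ℝ 2 w Ω)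
    (A B : ℝ) {x : EuclideanSpace ℝ (Fin d)} (hx : x ∈ Ω) :
    ellipticOp a b c t (fun y => A * v y + B * w y) x =
      A * ellipticOp a b c t v x + B * ellipticOp a b c t w x := by
  have hd : ∀ {v : EuclideanSpace ℝ (Fin d) → ℝ}, ContDiffOn ℝ 2 v Ω → ∀ y ∈ Ω,
      DifferentiableAt ℝ v y := fun hv y hy =>
    (hv.contDiffAt (hΩ.mem_nhds hy)).differentiableAt (by norm_num)
  have hflux : ∀ {v : EuclideanSpace ℝ (Fin d) → ℝ}, ContDiffOn ℝ 2 v Ω → ∀ i j,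
      DifferentiableAt ℝ (fun y => a y t i j * pderiv j v y) x := fun hv i j =>
    (((ha i j).mul (contDiffOn_pderiv hΩ hv j)).contDiffAt
      (hΩ.mem_nhds hx)).differentiableAt (by norm_num)
  have h2 : ∀ i j, pderiv i (fun y => a y t i j * pderiv j (fun z => A * v z + B * w z) y) x =
      A * pderiv i (fun y => a y t i j * pderiv j v y) x +
        B * pderiv i (fun y => a y t i j * pderiv j w y) x := by
    intro i j
    rw [← pderiv_linearCombination (hflux hv i j) (hflux hw i j)]
    unfold pderiv
    congr 1
    refine Filter.EventuallyEq.fderiv_eq ?_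
    filter_upwards [hΩ.mem_nhds hx] with y hy
    have := pderiv_linearCombination (hd hv y hy) (hd hw y hy) j A B
    unfold pderiv at this
    rw [this]
    ring
  unfold ellipticOp
  simp only [h2, pderiv_linearCombination (hd hv x hx) (hd hw x hx), mul_add,
    Finset.sum_add_distrib, mul_left_comm _ A, mul_left_comm _ B, ← Finset.mul_sum]
  ring

/-- The second-order necessary condition at a local maximum, along a direction `z`. -/
theorem IsLocalMax.fderiv_fderiv_apply_self_nonpos {F : Type*} [NormedAddCommGroup F]
    [NormedSpace ℝ F] {q : F → ℝ} {x : F} (hmax : IsLocalMax q x) (hq : ContDiffAt ℝ 2 q x)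
    (z : F) : fderiv ℝ (fderiv ℝ q) x z z ≤ 0 := by
  have hline : ∀ s : ℝ, HasDerivAt (fun s : ℝ => x + s • z) z s := fun s => by
    simpa using ((hasDerivAt_id s).smul_const z).const_add x
  have htend : Tendsto (fun s : ℝ => x + s • z) (𝓝 0) (𝓝 x) := by
    simpa using (hline 0).continuousAt.tendsto
  set φ : ℝ → ℝ := fun s => q (x + s • z) with hφ
  have hφmax : ∀ᶠ s in 𝓝 0, φ s ≤ φ 0 := by
    simpa [hφ] using htend.eventually hmax
  have hd1 : ∀ᶠ s in 𝓝 (0 : ℝ), deriv φ s = fderiv ℝ q (x + s • z) z := by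
    have h1 : ∀ᶠ y in 𝓝 x, DifferentiableAt ℝ q y :=
      (hq.eventually (by simp)).mono fun y hy => hy.differentiableAt (by norm_num)
    filter_upwards [htend.eventually h1] with s hs
    exact (hs.hasFDerivAt.comp_hasDerivAt s (hline s)).deriv
  have hd2 : deriv (deriv φ) 0 = fderiv ℝ (fderiv ℝ q) x z z := by
    rw [EventuallyEq.deriv_eq hd1]
    have h2 : DifferentiableAt ℝ (fderiv ℝ q) (x + (0 : ℝ) • z) := by
      simpa using (hq.fderiv_right (m := 1) (by norm_num)).differentiableAt (by norm_num)
    have h3 : HasDerivAt (fun s : ℝ => fderiv ℝ q (x + s • z))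
        (fderiv ℝ (fderiv ℝ q) (x + (0 : ℝ) • z) z) 0 :=
      h2.hasFDerivAt.comp_hasDerivAt (0 : ℝ) (hline 0)
    rw [zero_smul, add_zero] at h3
    exact (((ContinuousLinearMap.apply ℝ ℝ z).hasFDerivAt).comp_hasDerivAt (0 : ℝ) h3).deriv
  by_contra! hpos
  have hcont : ContinuousAt φ 0 := by
    have : ContinuousAt q (x + (0 : ℝ) • z) := by simpa using hq.continuousAt
    exact this.comp (f := fun s : ℝ => x + s • z) (hline 0).continuousAt
  have hd0 : deriv φ 0 = 0 := IsLocalMax.deriv_eq_zero hφmax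
  have hφmin : ∀ᶠ s in 𝓝 0, φ 0 ≤ φ s := isLocalMin_of_deriv_deriv_pos (by rwa [hd2]) hd0 hcont
  -- Both a maximum and, were the second derivative positive, a minimum: `φ` is locally constant.
  have hconst : φ =ᶠ[𝓝 0] fun _ => φ 0 := by
    filter_upwards [hφmax, hφmin] with s h1 h2 using le_antisymm h1 h2
  have : deriv (deriv φ) 0 = 0 := by
    rw [hconst.deriv.deriv_eq]
    simp
  linarith

/-- Maximum principle: the elliptic operator is nonnegative at an interior local maximum with
value zero; the value zero removes the zeroth-order term. -/
theorem ellipticOp_nonneg_of_isLocalMax {d : ℕ}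
    {a : EuclideanSpace ℝ (Fin d) → ℝ → Matrix (Fin d) (Fin d) ℝ}
    (b : EuclideanSpace ℝ (Fin d) → ℝ → Fin d → ℝ) (c : EuclideanSpace ℝ (Fin d) → ℝ → ℝ)
    {t : ℝ} {x : EuclideanSpace ℝ (Fin d)} (ha : (a x t).PosSemidef)
    (ha' : ∀ i j, DifferentiableAt ℝ (fun x => a x t i j) x)
    {q : EuclideanSpace ℝ (Fin d) → ℝ} (hq : ContDiffAt ℝ 2 q x) (hmax : IsLocalMax q x)
    (hq0 : q x = 0) : 0 ≤ ellipticOp a b c t q x := by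
  have hgrad : ∀ j, pderiv j q x = 0 := fun j => by simp [pderiv, hmax.fderiv_eq_zero]
  have hdd : DifferentiableAt ℝ (fderiv ℝ q) x :=
    (hq.fderiv_right (m := 1) (by norm_num)).differentiableAt (by norm_num)
  have hsecond : ∀ i j, pderiv i (fun y => a y t i j * pderiv j q y) x =
      a x t i j * fderiv ℝ (fderiv ℝ q) x (EuclideanSpace.single i 1)
        (EuclideanSpace.single j 1) := by
    intro i j
    have h1 : HasFDerivAt (pderiv j q)
        ((fderiv ℝ (fderiv ℝ q) x).flip (EuclideanSpace.single j 1)) x := by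
      have := hdd.hasFDerivAt.clm_apply
        (hasFDerivAt_const (EuclideanSpace.single j (1 : ℝ) : EuclideanSpace ℝ (Fin d)) x)
      rw [ContinuousLinearMap.comp_zero, zero_add] at this
      exact this
    have h2 := ((ha' i j).hasFDerivAt.mul h1).fderiv
    have h3 : fderiv ℝ (fun y => a y t i j * pderiv j q y) x = _ := h2
    rw [pderiv, h3, hgrad]
    simp
  obtain ⟨m, z, hz⟩ := Matrix.posSemidef_iff_eq_sum_vecMulVec.1 ha
  have hexp : ∀ k, fderiv ℝ (fderiv ℝ q) x (WithLp.toLp 2 (z k)) (WithLp.toLp 2 (z k)) =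
      ∑ i, ∑ j, z k i * z k j * fderiv ℝ (fderiv ℝ q) x (EuclideanSpace.single i 1)
        (EuclideanSpace.single j 1) := by
    intro k
    have h1 : (WithLp.toLp 2 (z k) : EuclideanSpace ℝ (Fin d)) =
        ∑ i, z k i • EuclideanSpace.single i (1 : ℝ) := by
      ext l
      simp [Finset.sum_apply, Pi.single_apply]
    rw [h1]
    simp only [map_sum, map_smul, sum_apply, smul_apply,
      smul_eq_mul, Finset.mul_sum]
    rw [Finset.sum_comm]
    refine Finset.sum_congr rfl fun i _ => Finset.sum_congr rfl fun j _ => ?_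
    ring
  have hsum : ∑ i, ∑ j, pderiv i (fun y => a y t i j * pderiv j q y) x =
      ∑ k, fderiv ℝ (fderiv ℝ q) x (WithLp.toLp 2 (z k)) (WithLp.toLp 2 (z k)) := by
    simp only [hsecond, hexp]
    rw [Finset.sum_comm]
    simp_rw [Finset.sum_comm (s := (Finset.univ : Finset (Fin m)))]
    rw [Finset.sum_comm]
    refine Finset.sum_congr rfl fun i _ => Finset.sum_congr rfl fun j _ => ?_
    rw [hz, Matrix.sum_apply, Finset.sum_mul]
    simp [Matrix.vecMulVec_apply]
  have hle : ∑ k, fderiv ℝ (fderiv ℝ q) x (WithLp.toLp 2 (z k)) (WithLp.toLp 2 (z k)) ≤ 0 :=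
    Finset.sum_nonpos fun k _ => hmax.fderiv_fderiv_apply_self_nonpos hq _
  simp only [ellipticOp, hsum, hgrad, hq0, mul_zero, Finset.sum_const_zero, add_zero]
  linarith

/-! ### The norm of `L_∞` on an open set -/

theorem ofReal_abs_le_linftyNorm {d : ℕ} {Ω : Set (EuclideanSpace ℝ (Fin d))} (hΩ : IsOpen Ω)
    {v : EuclideanSpace ℝ (Fin d) → ℝ} (hv : ContinuousOn v Ω) {x : EuclideanSpace ℝ (Fin d)}
    (hx : x ∈ Ω) : ENNReal.ofReal |v x| ≤ linftyNorm Ω v := by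
  have hopen : IsOpen (Ω ∩ {y | linftyNorm Ω v < ‖v y‖ₑ}) :=
    (continuous_enorm.comp_continuousOn hv).isOpen_inter_preimage hΩ isOpen_Ioi
  have hae : ∀ᵐ y ∂(volume.restrict Ω), ‖v y‖ₑ ≤ linftyNorm Ω v := by
    rw [linftyNorm, eLpNorm_exponent_top]
    exact enorm_ae_le_eLpNormEssSup v _
  rw [ae_restrict_iff' hΩ.measurableSet, ae_iff] at hae
  have hempty : Ω ∩ {y | linftyNorm Ω v < ‖v y‖ₑ} = ∅ := by
    refine hopen.eq_empty_of_measure_zero (μ := volume) ?_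
    convert hae using 2
    ext y
    simp
  by_contra! h
  have : x ∈ Ω ∩ {y | linftyNorm Ω v < ‖v y‖ₑ} := by
    refine ⟨hx, ?_⟩
    rwa [mem_ofPred_eq, Real.enorm_eq_ofReal_abs]
  rw [hempty] at this
  exact this

theorem linftyNorm_le_ofReal {d : ℕ} {Ω : Set (EuclideanSpace ℝ (Fin d))} (hΩ : IsOpen Ω)
    {v : EuclideanSpace ℝ (Fin d) → ℝ} {r : ℝ} (h : ∀ x ∈ Ω, |v x| ≤ r) :
    linftyNorm Ω v ≤ ENNReal.ofReal r := by
  rw [linftyNorm, eLpNorm_exponent_top]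
  refine eLpNormEssSup_le_of_ae_bound ?_
  filter_upwards [self_mem_ae_restrict hΩ.measurableSet] with x hx using h x hx

/-! ### The comparison principle -/

theorem ClassicalRegularity.caputoRegular {d : ℕ} {Ω : Set (EuclideanSpace ℝ (Fin d))} {T : ℝ}
    {w : EuclideanSpace ℝ (Fin d) → ℝ → ℝ} (hw : ClassicalRegularity Ω T w)
    {x : EuclideanSpace ℝ (Fin d)} (hx : x ∈ Ω) : CaputoRegular T (w x) :=
  ⟨hw.locW1Infty_time x hx, _, hw.continuous_at_zero x hx⟩

theorem ClassicalRegularity.sub {d : ℕ} {Ω : Set (EuclideanSpace ℝ (Fin d))} {T : ℝ}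
    {v w : EuclideanSpace ℝ (Fin d) → ℝ → ℝ} (hv : ClassicalRegularity Ω T v)
    (hw : ClassicalRegularity Ω T w) : ClassicalRegularity Ω T (fun x t => v x t - w x t) where
  contDiffOn_space t ht := (hv.contDiffOn_space t ht).sub (hw.contDiffOn_space t ht)
  locW1Infty_time x hx := by
    have := (hv.locW1Infty_time x hx).linearCombination (hw.locW1Infty_time x hx) 1 (-1)
    simpa only [one_mul, neg_one_mul, ← sub_eq_add_neg] using this
  continuous_at_zero x hx := (hv.continuous_at_zero x hx).sub (hw.continuous_at_zero x hx)
  continuousOn_closure := hv.continuousOn_closure.sub hw.continuousOn_closure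
  boundary x hx t ht := by rw [hv.boundary x hx t ht, hw.boundary x hx t ht, sub_zero]

theorem parabolicOp_sub {d : ℕ} {Ω : Set (EuclideanSpace ℝ (Fin d))} (hΩ : IsOpen Ω) {T α : ℝ}
    (hα : α < 1) {a : EuclideanSpace ℝ (Fin d) → ℝ → Matrix (Fin d) (Fin d) ℝ}
    (b : EuclideanSpace ℝ (Fin d) → ℝ → Fin d → ℝ) (c : EuclideanSpace ℝ (Fin d) → ℝ → ℝ)
    {t : ℝ} (ht : t ∈ Ioc 0 T) (ha : ∀ i j, ContDiffOn ℝ 1 (fun x => a x t i j) Ω)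
    {v w : EuclideanSpace ℝ (Fin d) → ℝ → ℝ} (hv : ClassicalRegularity Ω T v)
    (hw : ClassicalRegularity Ω T w) {x : EuclideanSpace ℝ (Fin d)} (hx : x ∈ Ω) :
    parabolicOp α a b c (fun x t => v x t - w x t) x t =
      parabolicOp α a b c v x t - parabolicOp α a b c w x t := by
  have h1 := (hv.caputoRegular hx).caputo_linearCombination (hw.caputoRegular hx) hα 1 (-1) ht
  have h2 := ellipticOp_linearCombination hΩ b c ha (hv.contDiffOn_space t ht)
    (hw.contDiffOn_space t ht) 1 (-1) hx
  simp only [one_mul, neg_one_mul, ← sub_eq_add_neg] at h1 h2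
  rw [parabolicOp, h1, h2, parabolicOp, parabolicOp]
  ring

/-- First contact: if `e` starts below the barrier `g(x) P(t)` but does not stay strictly below
it, there is a point of `Ω` and an earliest time at which the two agree. The set where `e` is at
least the positive lower bound `δ` of the barrier keeps away from the boundary and from `t = 0`,
so it is compact in `Ω × (0,T]`; no behaviour of `g` at the boundary is needed. -/
theorem exists_first_contact {d : ℕ} {Ω : Set (EuclideanSpace ℝ (Fin d))} (hΩ : IsOpen Ω)
    (hΩ_bdd : Bornology.IsBounded Ω) {T : ℝ} {e : EuclideanSpace ℝ (Fin d) → ℝ → ℝ}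
    (he : ClassicalRegularity Ω T e)
    (hsmall : ∀ δ : ℝ, 0 < δ → ∀ᶠ t in 𝓝[>] 0, ∀ x ∈ Ω, e x t < δ)
    {g : EuclideanSpace ℝ (Fin d) → ℝ} (hg : ContinuousOn g Ω) (hg1 : ∀ x ∈ Ω, 1 ≤ g x)
    {P : ℝ → ℝ} (hP : ContinuousOn P (Ioc 0 T)) {δ : ℝ} (hδ : 0 < δ)
    (hPδ : ∀ t ∈ Ioc 0 T, δ ≤ P t)
    (hcontact : ∃ x ∈ Ω, ∃ t ∈ Ioc 0 T, g x * P t ≤ e x t) :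
    ∃ x₀ ∈ Ω, ∃ t₀ ∈ Ioc 0 T, e x₀ t₀ = g x₀ * P t₀ ∧
      ∀ x ∈ Ω, ∀ s ∈ Ioc 0 t₀, e x s ≤ g x * P s := by
  obtain ⟨t₁, ht₁, hsmall'⟩ := mem_nhdsGT_iff_exists_Ioo_subset.1 (hsmall δ hδ)
  rw [mem_Ioi] at ht₁
  have hδg : ∀ x ∈ Ω, ∀ t ∈ Ioc 0 T, δ ≤ g x * P t := fun x hx t ht => by
    nlinarith [hg1 x hx, hPδ t ht]
  have hlate : ∀ x ∈ Ω, ∀ t ∈ Ioc 0 T, g x * P t ≤ e x t → t₁ ≤ t := by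
    intro x hx t ht hle
    by_contra! hlt
    exact absurd (hsmall' ⟨ht.1, hlt⟩ x hx) (not_lt.2 ((hδg x hx t ht).trans hle))
  have hsub : closure Ω ×ˢ Icc t₁ T ⊆ closure Ω ×ˢ Ioc 0 T :=
    prod_mono le_rfl fun t ht => ⟨ht₁.trans_le ht.1, ht.2⟩
  have hecont := he.continuousOn_closure.mono hsub
  have hbox : IsCompact (closure Ω ×ˢ Icc t₁ T) := hΩ_bdd.isCompact_closure.prod isCompact_Icc
  set K := (closure Ω ×ˢ Icc t₁ T) ∩ (fun p => e p.1 p.2) ⁻¹' Ici δ with hK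
  have hKc : IsCompact K := hbox.of_isClosed_subset
    (hecont.preimage_isClosed_of_isClosed hbox.isClosed isClosed_Ici) inter_subset_left
  have hKΩ : ∀ p ∈ K, p.1 ∈ Ω ∧ p.2 ∈ Ioc 0 T := by
    rintro p ⟨hp, hpδ⟩
    refine ⟨?_, (hsub hp).2⟩
    by_contra hpΩ
    have hfr : p.1 ∈ frontier Ω := by
      rw [hΩ.frontier_eq]
      exact ⟨hp.1, hpΩ⟩
    have h0 : δ ≤ e p.1 p.2 := hpδ
    rw [he.boundary p.1 hfr p.2 (hsub hp).2] at h0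
    linarith
  have hdiff : ContinuousOn (fun p : EuclideanSpace ℝ (Fin d) × ℝ => e p.1 p.2 - g p.1 * P p.2)
      K :=
    (hecont.mono inter_subset_left).sub
      ((hg.comp continuousOn_fst fun p hp => (hKΩ p hp).1).mul
        (hP.comp continuousOn_snd fun p hp => (hKΩ p hp).2))
  set C := K ∩ (fun p => e p.1 p.2 - g p.1 * P p.2) ⁻¹' Ici 0 with hC
  have hCc : IsCompact C := hKc.of_isClosed_subset
    (hdiff.preimage_isClosed_of_isClosed hKc.isClosed isClosed_Ici) inter_subset_left
  have hmemC : ∀ x ∈ Ω, ∀ t ∈ Ioc 0 T, g x * P t ≤ e x t → (x, t) ∈ C := fun x hx t ht hle =>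
    ⟨⟨⟨subset_closure hx, hlate x hx t ht hle, ht.2⟩, (hδg x hx t ht).trans hle⟩,
      sub_nonneg.2 hle⟩
  have hCne : C.Nonempty := by
    obtain ⟨x, hx, t, ht, hle⟩ := hcontact
    exact ⟨_, hmemC x hx t ht hle⟩
  obtain ⟨⟨x₀, t₀⟩, hmem, hmin⟩ := hCc.exists_isMinOn hCne continuous_snd.continuousOn
  obtain ⟨hx₀, ht₀⟩ := hKΩ _ hmem.1
  simp only at hx₀ ht₀
  have hbefore : ∀ x ∈ Ω, ∀ s ∈ Ioo 0 t₀, e x s ≤ g x * P s := by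
    intro x hx s hs
    by_contra! hlt
    have h1 : t₀ ≤ s := hmin (hmemC x hx s ⟨hs.1, hs.2.le.trans ht₀.2⟩ hlt.le)
    linarith [hs.2]
  have hbelow : ∀ x ∈ Ω, ∀ s ∈ Ioc 0 t₀, e x s ≤ g x * P s := by
    intro x hx s hs
    rcases hs.2.eq_or_lt with h | h
    · subst h
      have hmono : 𝓝[<] s ≤ 𝓝[Ioc 0 T] s := by
        rw [← nhdsWithin_Ioo_eq_nhdsLT hs.1]
        exact nhdsWithin_mono _ fun r hr => ⟨hr.1, hr.2.le.trans ht₀.2⟩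
      have h1 := ((he.locW1Infty_time x hx).continuousOn s ht₀).tendsto.mono_left hmono
      have h2 := ((hP s ht₀).tendsto.mono_left hmono).const_mul (g x)
      refine le_of_tendsto_of_tendsto h1 h2 ?_
      filter_upwards [Ioo_mem_nhdsLT hs.1] with r hr using hbefore x hx r hr
    · exact hbefore x hx s ⟨hs.1, h⟩
  exact ⟨x₀, hx₀, t₀, ht₀,
    le_antisymm (hbelow x₀ hx₀ t₀ ⟨ht₀.1, le_rfl⟩) (sub_nonneg.1 hmem.2), hbelow⟩

/-- Comparison with a strict barrier `g(x) P(t)` that is bounded away from zero for `t > 0`. -/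
theorem lt_of_parabolicOp_lt {d : ℕ} {Ω : Set (EuclideanSpace ℝ (Fin d))} (hΩ : IsOpen Ω)
    (hΩ_bdd : Bornology.IsBounded Ω) {T α : ℝ} (hα : α ∈ Ioo (0 : ℝ) 1)
    {a : EuclideanSpace ℝ (Fin d) → ℝ → Matrix (Fin d) (Fin d) ℝ}
    {b : EuclideanSpace ℝ (Fin d) → ℝ → Fin d → ℝ} {c : EuclideanSpace ℝ (Fin d) → ℝ → ℝ}
    (ha_pos : ∀ x ∈ Ω, ∀ t ∈ Ioc 0 T, (a x t).PosSemidef)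
    (ha_smooth : ∀ t ∈ Ioc 0 T, ∀ i j, ContDiffOn ℝ 1 (fun x => a x t i j) Ω)
    {e : EuclideanSpace ℝ (Fin d) → ℝ → ℝ} (he : ClassicalRegularity Ω T e)
    (he0 : ∀ x ∈ Ω, e x 0 ≤ 0)
    (hsmall : ∀ δ : ℝ, 0 < δ → ∀ᶠ t in 𝓝[>] 0, ∀ x ∈ Ω, e x t < δ)
    {lam : ℝ} {g : EuclideanSpace ℝ (Fin d) → ℝ} (hg : ContDiffOn ℝ 2 g Ω)
    (hg_op : ∀ t ∈ Ioc 0 T, ∀ x ∈ Ω, lam ≤ ellipticOp a b c t g x)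
    (hg1 : ∀ x ∈ Ω, 1 ≤ g x)
    {P : ℝ → ℝ} (hP : CaputoRegular T P) (hP0 : 0 ≤ P 0) {δ : ℝ} (hδ : 0 < δ)
    (hPδ : ∀ t ∈ Ioc 0 T, δ ≤ P t)
    (hlt : ∀ t ∈ Ioc 0 T, ∀ x ∈ Ω,
      parabolicOp α a b c e x t < g x * caputo α P t + lam * P t) :
    ∀ t ∈ Ioc 0 T, ∀ x ∈ Ω, e x t < g x * P t := by
  by_contra! hcontact
  obtain ⟨t', ht', x', hx', hle'⟩ := hcontact
  obtain ⟨x₀, hx₀, t₀, ht₀, heq, hbelow⟩ := exists_first_contact hΩ hΩ_bdd he hsmall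
    hg.continuousOn hg1 hP.1.continuousOn hδ hPδ ⟨x', hx', t', ht', hle'⟩
  have hspace := he.contDiffOn_space t₀ ht₀
  -- In space, `e - P(t₀) g` has a maximum with value zero at `x₀`.
  have hell : P t₀ * ellipticOp a b c t₀ g x₀ ≤ ellipticOp a b c t₀ (fun y => e y t₀) x₀ := by
    have h1 := ellipticOp_linearCombination hΩ b c (ha_smooth t₀ ht₀) hspace hg 1 (-P t₀) hx₀
    have h2 : 0 ≤ ellipticOp a b c t₀ (fun y => 1 * e y t₀ + -P t₀ * g y) x₀ := by
      refine ellipticOp_nonneg_of_isLocalMax b c (ha_pos x₀ hx₀ t₀ ht₀) ?_ ?_ ?_ ?_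
      · exact fun i j => ((ha_smooth t₀ ht₀ i j).contDiffAt
          (hΩ.mem_nhds hx₀)).differentiableAt (by norm_num)
      · exact ((contDiffOn_const.mul hspace).add (contDiffOn_const.mul hg)).contDiffAt
          (hΩ.mem_nhds hx₀)
      · filter_upwards [hΩ.mem_nhds hx₀] with y hy
        have := hbelow y hy t₀ ⟨ht₀.1, le_rfl⟩
        rw [heq]
        linarith
      · rw [heq]
        ring
    linarith
  -- In time, `e(x₀,·) - g(x₀) P` has its maximum over the past, again zero, at `t₀`.
  have hcap : g x₀ * caputo α P t₀ ≤ caputo α (e x₀) t₀ := by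
    have hex := he.caputoRegular hx₀
    have h1 := hex.caputo_linearCombination hP hα.2 1 (-g x₀) ht₀
    have h2 : 0 ≤ caputo α (fun s => 1 * e x₀ s + -g x₀ * P s) t₀ := by
      refine (hex.linearCombination hP 1 (-g x₀)).caputo_nonneg_of_forall_le hα ht₀ fun s hs => ?_
      have hle : e x₀ s ≤ g x₀ * P s := by
        rcases hs.1.eq_or_lt with h | h
        · subst h
          exact (he0 x₀ hx₀).trans (mul_nonneg (by linarith [hg1 x₀ hx₀]) hP0)
        · exact hbelow x₀ hx₀ s ⟨h, hs.2⟩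
      rw [heq]
      linarith
    linarith
  have h1 := mul_le_mul_of_nonneg_left (hg_op t₀ ht₀ x₀ hx₀) (hδ.le.trans (hPδ t₀ ht₀))
  have h2 := hlt t₀ ht₀ x₀ hx₀
  rw [parabolicOp] at h2
  linarith

/-- One-sided barrier estimate. The barrier `g E / (1 + ω)` is approached by the strict barriers
`g (E / (1 + ω) + δ Ψ)` as `δ → 0`, where `Ψ` is an exponential with a jump at `t = 0` whose rate
is large enough to absorb a negative `lam`. -/
theorem le_of_parabolicOp_le {d : ℕ} {Ω : Set (EuclideanSpace ℝ (Fin d))} (hΩ : IsOpen Ω)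
    (hΩ_bdd : Bornology.IsBounded Ω) {T α : ℝ} (hα : α ∈ Ioo (0 : ℝ) 1)
    {a : EuclideanSpace ℝ (Fin d) → ℝ → Matrix (Fin d) (Fin d) ℝ}
    {b : EuclideanSpace ℝ (Fin d) → ℝ → Fin d → ℝ} {c : EuclideanSpace ℝ (Fin d) → ℝ → ℝ}
    (ha_pos : ∀ x ∈ Ω, ∀ t ∈ Ioc 0 T, (a x t).PosSemidef)
    (ha_smooth : ∀ t ∈ Ioc 0 T, ∀ i j, ContDiffOn ℝ 1 (fun x => a x t i j) Ω)
    {e : EuclideanSpace ℝ (Fin d) → ℝ → ℝ} (he : ClassicalRegularity Ω T e)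
    (he0 : ∀ x ∈ Ω, e x 0 ≤ 0)
    (hsmall : ∀ δ : ℝ, 0 < δ → ∀ᶠ t in 𝓝[>] 0, ∀ x ∈ Ω, e x t < δ)
    {lam ω : ℝ} (hω : 0 ≤ ω) {g : EuclideanSpace ℝ (Fin d) → ℝ} (hg : ContDiffOn ℝ 2 g Ω)
    (hg_op : ∀ t ∈ Ioc 0 T, ∀ x ∈ Ω, lam ≤ ellipticOp a b c t g x)
    (hg_bounds : ∀ x ∈ Ω, 1 ≤ g x ∧ g x ≤ 1 + ω)
    {E : ℝ → ℝ} (hE : CaputoRegular T E) (hE_nonneg : ∀ t ∈ Icc 0 T, 0 ≤ E t)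
    (hE_caputo : ∀ t ∈ Ioc 0 T, 0 ≤ ω * caputo α E t)
    (hle : ∀ t ∈ Ioc 0 T, ∀ x ∈ Ω,
      parabolicOp α a b c e x t ≤ (caputo α E t + lam * E t) / (1 + ω)) :
    ∀ t ∈ Ioc 0 T, ∀ x ∈ Ω, e x t ≤ E t := by
  intro t ht x hx
  obtain ⟨μ, hμ, hΨ⟩ := exists_mul_jumpExp_le_caputo hα (|lam| + 1)
  have hω1 : 0 < 1 + ω := by linarith
  have hT : 0 ≤ T := ht.1.le.trans ht.2
  -- If `ω = 0` then `g = 1`, and otherwise the Caputo derivative of `E` is nonnegative.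
  have hgE : ∀ s ∈ Ioc 0 T, ∀ y ∈ Ω, caputo α E s ≤ g y * caputo α E s := by
    intro s hs y hy
    obtain ⟨h1, h2⟩ := hg_bounds y hy
    rcases hω.eq_or_lt with h | h
    · have : g y = 1 := le_antisymm (by linarith) h1
      rw [this, one_mul]
    · have : 0 ≤ caputo α E s := nonneg_of_mul_nonneg_right (hE_caputo s hs) h
      nlinarith
  have hstrict : ∀ δ : ℝ, 0 < δ → e x t < g x * ((1 + ω)⁻¹ * E t + δ * jumpExp μ t) := by
    intro δ hδ
    refine lt_of_parabolicOp_lt (P := fun s => (1 + ω)⁻¹ * E s + δ * jumpExp μ s) hΩ hΩ_bdd hα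
      ha_pos ha_smooth he he0 hsmall hg hg_op (fun y hy => (hg_bounds y hy).1)
      (hE.linearCombination (caputoRegular_jumpExp T μ) _ _) ?_ hδ ?_ ?_ t ht x hx
    · rw [jumpExp_zero, mul_zero, add_zero]
      exact mul_nonneg (inv_nonneg.2 hω1.le) (hE_nonneg 0 ⟨le_rfl, hT⟩)
    · intro s hs
      have h1 : 1 ≤ jumpExp μ s := by
        rw [jumpExp_of_pos μ hs.1]
        exact Real.one_le_exp (mul_nonneg hμ hs.1.le)
      have h2 := mul_nonneg (inv_nonneg.2 hω1.le) (hE_nonneg s ⟨hs.1.le, hs.2⟩)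
      nlinarith
    · intro s hs y hy
      rw [hE.caputo_linearCombination (caputoRegular_jumpExp T μ) hα.2 _ _ hs]
      have hpos : 0 < jumpExp μ s := by
        rw [jumpExp_of_pos μ hs.1]
        exact Real.exp_pos _
      have h1 : 0 < g y * caputo α (jumpExp μ) s + lam * jumpExp μ s := by
        have h2 := hΨ s hs.1
        have h3 : 0 ≤ caputo α (jumpExp μ) s := le_trans (by positivity) h2
        have h4 := mul_le_mul_of_nonneg_right (hg_bounds y hy).1 h3
        have h5 := mul_le_mul_of_nonneg_right (neg_abs_le lam) hpos.le
        nlinarith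
      have h6 := mul_le_mul_of_nonneg_left (hgE s hs y hy) (inv_nonneg.2 hω1.le)
      have h7 := hle s hs y hy
      rw [div_eq_inv_mul] at h7
      nlinarith [mul_pos hδ h1]
  have hlim : e x t ≤ g x * ((1 + ω)⁻¹ * E t) := by
    have h1 : Tendsto (fun δ : ℝ => g x * ((1 + ω)⁻¹ * E t + δ * jumpExp μ t)) (𝓝[>] 0)
        (𝓝 (g x * ((1 + ω)⁻¹ * E t))) := by
      have : Continuous fun δ : ℝ => g x * ((1 + ω)⁻¹ * E t + δ * jumpExp μ t) := by fun_prop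
      simpa using (this.tendsto 0).mono_left (nhdsWithin_le_nhds (s := Ioi 0))
    refine ge_of_tendsto h1 ?_
    filter_upwards [self_mem_nhdsWithin] with δ hδ using (hstrict δ hδ).le
  refine hlim.trans ?_
  have h1 := hE_nonneg t ⟨ht.1.le, ht.2⟩
  calc g x * ((1 + ω)⁻¹ * E t) ≤ (1 + ω) * ((1 + ω)⁻¹ * E t) := by
        refine mul_le_mul_of_nonneg_right (hg_bounds x hx).2 (by positivity)
    _ = E t := by rw [mul_inv_cancel_left₀ hω1.ne']

theorem mainTheorem1 (d : ℕ) (Ω : Set (EuclideanSpace ℝ (Fin d)))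
    (hΩ_open : IsOpen Ω) (hΩ_bdd : Bornology.IsBounded Ω)
    (T α : ℝ) (hT : 0 < T) (hα : α ∈ Ioo (0 : ℝ) 1)
    (a : EuclideanSpace ℝ (Fin d) → ℝ → Matrix (Fin d) (Fin d) ℝ)
    (b : EuclideanSpace ℝ (Fin d) → ℝ → Fin d → ℝ)
    (c : EuclideanSpace ℝ (Fin d) → ℝ → ℝ)
    (ha_pos : ∀ x ∈ Ω, ∀ t ∈ Ioc 0 T, (a x t).PosDef)
    (ha_smooth : ∀ t ∈ Ioc 0 T, ∀ i j, ContDiffOn ℝ 1 (fun x => a x t i j) Ω)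
    (f : EuclideanSpace ℝ (Fin d) → ℝ → ℝ) (u₀ : EuclideanSpace ℝ (Fin d) → ℝ)
    (u uh : EuclideanSpace ℝ (Fin d) → ℝ → ℝ)
    (hu : IsClassicalSolution Ω T α a b c f u₀ u)
    (huh : ClassicalRegularity Ω T uh)
    (huh_initial : ∀ x ∈ Ω, uh x 0 = u₀ x)
    (herr_initial :
      Tendsto (fun t => linftyNorm Ω (fun x => uh x t - u x t)) (𝓝[>] 0) (𝓝 0))
    (hres_cont : ∀ t ∈ Ioc 0 T, ContinuousOn (fun x => problemResidual α a b c f uh x t) Ω)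
    (lam ω : ℝ) (hω : 0 ≤ ω)
    (g : EuclideanSpace ℝ (Fin d) → ℝ) (hg_smooth : ContDiffOn ℝ 2 g Ω)
    (hg_op : ∀ t ∈ Ioc 0 T, ∀ x ∈ Ω, lam ≤ ellipticOp a b c t g x)
    (hg_bounds : ∀ x ∈ Ω, 1 ≤ g x ∧ g x ≤ 1 + ω)
    (E : ℝ → ℝ) (hE_nonneg : ∀ t ∈ Icc 0 T, 0 ≤ E t)
    (hE_reg : LocW1Infty T E)
    (hE_lim : ∃ l : ℝ, Tendsto E (𝓝[>] 0) (𝓝 l))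
    (hE_caputo : ∀ t ∈ Ioc 0 T, 0 ≤ ω * caputo α E t)
    (hres : ∀ t ∈ Ioc 0 T,
      ((linftyNorm Ω (fun x => problemResidual α a b c f uh x t) : ℝ≥0∞) : EReal)
        ≤ (((caputo α E t + lam * E t) / (1 + ω) : ℝ) : EReal)) :
    ∀ t ∈ Icc 0 T,
      ((linftyNorm Ω (fun x => uh x t - u x t) : ℝ≥0∞) : EReal) ≤ ((E t : ℝ) : EReal) := by
  have hω1 : 0 < 1 + ω := by linarith
  have hE : CaputoRegular T E := ⟨hE_reg, hE_lim⟩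
  have ha : ∀ x ∈ Ω, ∀ t ∈ Ioc 0 T, (a x t).PosSemidef := fun x hx t ht =>
    (ha_pos x hx t ht).posSemidef
  have herr := huh.sub hu.regular
  have hres' : ∀ t ∈ Ioc 0 T, ∀ x ∈ Ω, |problemResidual α a b c f uh x t| ≤
      (caputo α E t + lam * E t) / (1 + ω) := by
    intro t ht x hx
    have h1 := EReal.coe_ennreal_le_coe_ennreal_iff.2
      (ofReal_abs_le_linftyNorm hΩ_open (hres_cont t ht) hx)
    have h2 := h1.trans (hres t ht)
    rw [EReal.coe_ennreal_ofReal, max_eq_left (abs_nonneg _)] at h2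
    exact EReal.coe_le_coe_iff.1 h2
  have hsmall : ∀ δ : ℝ, 0 < δ → ∀ᶠ t in 𝓝[>] 0, ∀ x ∈ Ω, |uh x t - u x t| < δ := by
    intro δ hδ
    filter_upwards [herr_initial.eventually_lt_const (ENNReal.ofReal_pos.2 hδ),
      Ioc_mem_nhdsGT hT] with t h1 ht x hx
    have h2 := ofReal_abs_le_linftyNorm hΩ_open (herr.contDiffOn_space t ht).continuousOn hx
    exact (ENNReal.ofReal_lt_ofReal_iff hδ).1 (h2.trans_lt h1)
  have hupper : ∀ t ∈ Ioc 0 T, ∀ x ∈ Ω, uh x t - u x t ≤ E t := by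
    refine le_of_parabolicOp_le hΩ_open hΩ_bdd hα ha ha_smooth herr
      (fun x hx => by rw [huh_initial x hx, hu.initial x hx, sub_self])
      (fun δ hδ => (hsmall δ hδ).mono fun t ht x hx => (abs_lt.1 (ht x hx)).2)
      hω hg_smooth hg_op hg_bounds hE hE_nonneg hE_caputo fun t ht x hx => ?_
    rw [parabolicOp_sub hΩ_open hα.2 b c ht (ha_smooth t ht) huh hu.regular hx,
      hu.equation x hx t ht]
    exact (abs_le.1 (hres' t ht x hx)).2
  have hlower : ∀ t ∈ Ioc 0 T, ∀ x ∈ Ω, u x t - uh x t ≤ E t := by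
    refine le_of_parabolicOp_le hΩ_open hΩ_bdd hα ha ha_smooth (hu.regular.sub huh)
      (fun x hx => by rw [huh_initial x hx, hu.initial x hx, sub_self])
      (fun δ hδ => (hsmall δ hδ).mono fun t ht x hx => by linarith [(abs_lt.1 (ht x hx)).1])
      hω hg_smooth hg_op hg_bounds hE hE_nonneg hE_caputo fun t ht x hx => ?_
    rw [parabolicOp_sub hΩ_open hα.2 b c ht (ha_smooth t ht) hu.regular huh hx,
      hu.equation x hx t ht]
    have := (abs_le.1 (hres' t ht x hx)).1
    rw [problemResidual] at this
    linarith
  intro t ht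
  have hE0 := hE_nonneg t ht
  have hbound : ∀ x ∈ Ω, |uh x t - u x t| ≤ E t := by
    intro x hx
    rcases ht.1.eq_or_lt with h | h
    · subst h
      rwa [huh_initial x hx, hu.initial x hx, sub_self, abs_zero]
    · exact abs_le.2 ⟨by linarith [hlower t ⟨h, ht.2⟩ x hx], hupper t ⟨h, ht.2⟩ x hx⟩
  have := EReal.coe_ennreal_le_coe_ennreal_iff.2 (linftyNorm_le_ofReal hΩ_open hbound)
  rwa [EReal.coe_ennreal_ofReal, max_eq_left hE0] at this
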